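/- Let $n\ge 2$, let $\Omega\subset\mathbb{R}^n$ be a bounded open set with Lipschitz boundary, and let $f,g\in L^\infty(\mathbb{R}^n)$ be real-valued with $g\ge 0$ a.e. Let $H^1_0(\Omega)$ be the completion of $C_c^\infty(\Omega)$ in the $H^1(\Omega)$-norm, let $$\mathbb{K}(\Omega)=\{u\in H^1_0(\Omega) : u\ge 0 \text{ a.e. in } \Omega\},$$ and let $$\lambda^*(\Omega)=\inf_{\phi\in C_c^\infty(\Omega),\ \phi\not\equiv 0}\frac{\|\nabla\phi\|_{L^2(\Omega)}^2}{\|\phi\|_{L^2(\Omega)}^2}$$ be the fundamental tone of $\Omega$ (with $\inf\emptyset=+\infty$). Let $\lambda\in\mathbb{R}$ with $\lambda<\lambda^*(\Omega)$, and for $u\in H_0^1(\Omega)$ put $$\mathcal{J}_{f,g,\lambda,\Omega}(u)=\int_\Omega\bigl(|\nabla u|^2-\lambda |u|^2-2fu+g^2\chi_{\{u>0\}}\bigr)\,dx,$$ where $\{u>0\}=\{x\in\Omega : u(x)>0\}$, which is defined up to a null set. Then $\mathcal{J}_{f,g,\lambda,\Omega}$ has a global minimizer in $\mathbb{K}(\Omega)$: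 there is $u_*\in\mathbb{K}(\Omega)$ such that $\mathcal{J}_{f,g,\lambda,\Omega}(u_*)\le\mathcal{J}_{f,g,\lambda,\Omega}(u)$ for all $u\in\mathbb{K}(\Omega)$. -/

import Mathlib

open MeasureTheory
open scoped NNReal ENNReal ContDiff Distributions Gradient

noncomputable section

namespace FreeBoundary

/-- Euclidean space `ℝⁿ`. -/
abbrev Rn (n : ℕ) : Type := EuclideanSpace ℝ (Fin n)

/-- The open set `Ω` has Lipschitz boundary: near each boundary point, in a suitable orthogonal
coordinate system with "vertical" unit vector `e`, the set `Ω` is the strict epigraph of a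
Lipschitz function `ψ` on the hyperplane orthogonal to `e`. -/
def HasLipschitzBoundary {n : ℕ} (Ω : Set (Rn n)) : Prop :=
  ∀ x₀ ∈ frontier Ω, ∃ r : ℝ, 0 < r ∧ ∃ e : Rn n, ‖e‖ = 1 ∧
    ∃ (K : ℝ≥0) (ψ : (ℝ ∙ e)ᗮ → ℝ), LipschitzWith K ψ ∧
      ∀ y ∈ Metric.ball x₀ r,
        (y ∈ Ω ↔ ψ ((ℝ ∙ e)ᗮ.orthogonalProjectionOnto y) < inner ℝ e y)

/-- The Hilbert space `L²(Ω) × L²(Ω; ℝⁿ)`. For a pair `(u, ∇u)` its norm is the `H¹(Ω)`-norm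
`(‖u‖² + ‖∇u‖²)^(1/2)`. -/
abbrev L2Pair {n : ℕ} (Ω : TopologicalSpace.Opens (Rn n)) : Type :=
  WithLp 2 (Lp ℝ 2 (volume.restrict (Ω : Set (Rn n))) ×
    Lp (Rn n) 2 (volume.restrict (Ω : Set (Rn n))))

section TestFunctions

variable {n : ℕ} {Ω : TopologicalSpace.Opens (Rn n)}

theorem memLp_test (φ : 𝓓(Ω, ℝ)) : MemLp (φ : Rn n → ℝ) 2 (volume.restrict (Ω : Set (Rn n))) :=
  φ.continuous.memLp_of_hasCompactSupport φ.hasCompactSupport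

theorem differentiable_test (φ : 𝓓(Ω, ℝ)) : Differentiable ℝ (φ : Rn n → ℝ) :=
  φ.contDiff.differentiable (by simp)

theorem continuous_gradient_test (φ : 𝓓(Ω, ℝ)) : Continuous (∇ (φ : Rn n → ℝ)) :=
  (LinearIsometryEquiv.continuous _).comp (φ.contDiff.continuous_fderiv (by simp))

theorem memLp_gradient_test (φ : 𝓓(Ω, ℝ)) :
    MemLp (∇ (φ : Rn n → ℝ)) 2 (volume.restrict (Ω : Set (Rn n))) :=
  (continuous_gradient_test φ).memLp_of_hasCompactSupport
    ((φ.hasCompactSupport.fderiv ℝ).comp_left (map_zero _))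

end TestFunctions

/-- The linear map `φ ↦ (φ, ∇φ)` from `C_c^∞(Ω)` to `L²(Ω) × L²(Ω; ℝⁿ)`; it is isometric for the
`H¹(Ω)`-norm on `C_c^∞(Ω)`. -/
def testGraph {n : ℕ} (Ω : TopologicalSpace.Opens (Rn n)) : 𝓓(Ω, ℝ) →ₗ[ℝ] L2Pair Ω where
  toFun φ := WithLp.toLp 2 ((memLp_test φ).toLp φ, (memLp_gradient_test φ).toLp (∇ φ))
  map_add' φ ψ := by
    have h : ∇ (⇑(φ + ψ) : Rn n → ℝ) = ∇ (φ : Rn n → ℝ) + ∇ (ψ : Rn n → ℝ) := by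
      funext x
      simp [gradient, fderiv_add (differentiable_test φ x) (differentiable_test ψ x)]
    rw [← WithLp.toLp_add, Prod.mk_add_mk, ← MemLp.toLp_add, ← MemLp.toLp_add]
    simp only [h]
    rfl
  map_smul' c φ := by
    have h : ∇ (⇑(c • φ) : Rn n → ℝ) = c • ∇ (φ : Rn n → ℝ) := by
      funext x
      simp [gradient, fderiv_const_smul (differentiable_test φ x)]
    rw [RingHom.id_apply, ← WithLp.toLp_smul, Prod.smul_mk, ← MemLp.toLp_const_smul,
      ← MemLp.toLp_const_smul]
    simp only [h]
    rfl

/-- `H¹₀(Ω)`: the completion of `C_c^∞(Ω)` in the `H¹(Ω)`-norm, realised as the closure of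
`{(φ, ∇φ) : φ ∈ C_c^∞(Ω)}` in `L²(Ω) × L²(Ω; ℝⁿ)`. An element is a pair consisting of the
function `u = p.fst` and of its weak gradient `∇u = p.snd`. -/
def H10 {n : ℕ} (Ω : TopologicalSpace.Opens (Rn n)) : Submodule ℝ (L2Pair Ω) :=
  (LinearMap.range (testGraph Ω)).topologicalClosure

/-- The constraint set `K(Ω) = {u ∈ H¹₀(Ω) : u ≥ 0 a.e. in Ω}`. -/
def constraintSet {n : ℕ} (Ω : TopologicalSpace.Opens (Rn n)) : Set (L2Pair Ω) :=
  {p | p ∈ H10 Ω ∧ ∀ᵐ x ∂(volume.restrict (Ω : Set (Rn n))), 0 ≤ p.fst x}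

/-- The fundamental tone `λ*(Ω)`: the infimum of the Rayleigh quotients `‖∇φ‖² / ‖φ‖²` over the
test functions `φ ≢ 0` (in `[-∞, ∞]`, so that it is `∞` when there is no such test function). -/
def fundamentalTone {n : ℕ} (Ω : TopologicalSpace.Opens (Rn n)) : EReal :=
  ⨅ φ : {φ : 𝓓(Ω, ℝ) // φ ≠ 0},
    (((∫ x in (Ω : Set (Rn n)), ‖∇ (φ.1 : Rn n → ℝ) x‖ ^ 2) /
      (∫ x in (Ω : Set (Rn n)), (φ.1 x) ^ 2) : ℝ) : EReal)

/-- The integrand `|∇u|² - λ u² - 2 f u + g² χ_{u > 0}` for `p = (u, ∇u)`. -/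
def energyDensity {n : ℕ} {Ω : TopologicalSpace.Opens (Rn n)} (f g : Rn n → ℝ) (lam : ℝ)
    (p : L2Pair Ω) (x : Rn n) : ℝ :=
  ‖p.snd x‖ ^ 2 - lam * (p.fst x) ^ 2 - 2 * f x * p.fst x +
    (g x) ^ 2 * Set.indicator {y | 0 < p.fst y} (fun _ => (1 : ℝ)) x

/-- The functional `J_{f,g,λ,Ω}(u) = ∫_Ω (|∇u|² - λ u² - 2 f u + g² χ_{u > 0}) dx`. -/
def energy {n : ℕ} (Ω : TopologicalSpace.Opens (Rn n)) (f g : Rn n → ℝ) (lam : ℝ)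
    (p : L2Pair Ω) : ℝ :=
  ∫ x in (Ω : Set (Rn n)), energyDensity f g lam p x

/-- On a bounded open set and for `f, g ∈ L^∞` the integrand is integrable, so that the integral
in the definition of the functional is a genuine one. -/
theorem integrable_energyDensity {n : ℕ} {Ω : TopologicalSpace.Opens (Rn n)}
    (hb : Bornology.IsBounded (Ω : Set (Rn n))) {f g : Rn n → ℝ}
    (hf : MemLp f ∞ volume) (hg : MemLp g ∞ volume) (lam : ℝ) (p : L2Pair Ω) :
    Integrable (energyDensity f g lam p) (volume.restrict (Ω : Set (Rn n))) := by
  have : IsFiniteMeasure (volume.restrict (Ω : Set (Rn n))) :=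
    ⟨by simpa using hb.measure_lt_top⟩
  have hf2 : MemLp f 2 (volume.restrict (Ω : Set (Rn n))) :=
    (hf.restrict _).mono_exponent le_top
  have hg2 : MemLp g 2 (volume.restrict (Ω : Set (Rn n))) :=
    (hg.restrict _).mono_exponent le_top
  have hu := Lp.memLp p.fst
  have hG := Lp.memLp p.snd
  have hm : MeasurableSet {y | 0 < p.fst y} :=
    measurableSet_lt measurable_const (Lp.stronglyMeasurable p.fst).measurable
  have h4 := hg2.integrable_sq.indicator hm
  have h3 := (hf2.integrable_mul hu).const_mul 2
  refine (((hG.integrable_norm_pow (by simp)).sub (hu.integrable_sq.const_mul lam)).sub h3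
    |>.add h4).congr (Filter.Eventually.of_forall fun x => ?_)
  by_cases hx : 0 < p.fst x <;>
    simp [energyDensity, Set.indicator, hx, mul_assoc]

/-- For `p ∈ H¹₀(Ω)`, the second component of `p` is the weak gradient of the first. -/
theorem weakGradient_of_mem_H10 {n : ℕ} {Ω : TopologicalSpace.Opens (Rn n)} {p : L2Pair Ω}
    (hp : p ∈ H10 Ω) (ψ : 𝓓(Ω, ℝ)) (v : Rn n) :
    ∫ x in (Ω : Set (Rn n)), p.fst x * inner ℝ v (∇ (ψ : Rn n → ℝ) x) =
      - ∫ x in (Ω : Set (Rn n)), inner ℝ v (p.snd x) * ψ x := by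
  have hA : MemLp (fun x => inner ℝ v (∇ (ψ : Rn n → ℝ) x)) 2
      (volume.restrict (Ω : Set (Rn n))) := (memLp_gradient_test ψ).const_inner v
  have hB : MemLp (fun x => ψ x • v) 2 (volume.restrict (Ω : Set (Rn n))) := by
    refine Continuous.memLp_of_hasCompactSupport (ψ.continuous.smul continuous_const) ?_
    exact ψ.hasCompactSupport.smul_right
  have e1 : ∀ q : L2Pair Ω, ∫ x in (Ω : Set (Rn n)), q.fst x * inner ℝ v (∇ (ψ : Rn n → ℝ) x) =
      inner ℝ (hA.toLp _) q.fst := fun q => by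
    rw [L2.inner_def]
    refine integral_congr_ae ?_
    filter_upwards [hA.coeFn_toLp] with x hx
    rw [hx]; simp
  have e2 : ∀ q : L2Pair Ω, ∫ x in (Ω : Set (Rn n)), inner ℝ v (q.snd x) * ψ x =
      inner ℝ (hB.toLp _) q.snd := fun q => by
    rw [L2.inner_def]
    refine integral_congr_ae ?_
    filter_upwards [hB.coeFn_toLp] with x hx
    rw [hx, inner_smul_left]; simp [mul_comm]
  have hcl : IsClosed {q : L2Pair Ω |
      inner ℝ (hA.toLp _) q.fst = - inner ℝ (hB.toLp _) q.snd} :=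
    isClosed_eq (by fun_prop) (by fun_prop)
  rw [e1, e2]
  refine closure_minimal ?_ hcl hp
  rintro _ ⟨φ, rfl⟩
  change inner ℝ (hA.toLp _) _ = - inner ℝ (hB.toLp _) _
  rw [← e1, ← e2]
  have g1 : ∀ (χ : 𝓓(Ω, ℝ)) x, inner ℝ v (∇ (χ : Rn n → ℝ) x) = fderiv ℝ χ x v := fun χ x => by
    rw [gradient, real_inner_comm, InnerProductSpace.toDual_symm_apply]
  have l1 : ∫ x in (Ω : Set (Rn n)), (testGraph Ω φ).fst x * inner ℝ v (∇ (ψ : Rn n → ℝ) x) =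
      ∫ x, φ x * fderiv ℝ ψ x v := by
    rw [← setIntegral_eq_integral_of_forall_compl_eq_zero (s := (Ω : Set (Rn n)))
      (f := fun x => φ x * fderiv ℝ ψ x v)]
    · refine integral_congr_ae ?_
      filter_upwards [(memLp_test φ).coeFn_toLp] with x hx
      rw [← g1, ← hx]; rfl
    · intro x hx
      rw [image_eq_zero_of_notMem_tsupport fun h => hx (φ.tsupport_subset h), zero_mul]
  have l2 : ∫ x in (Ω : Set (Rn n)), inner ℝ v ((testGraph Ω φ).snd x) * ψ x =
      ∫ x, fderiv ℝ φ x v * ψ x := by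
    rw [← setIntegral_eq_integral_of_forall_compl_eq_zero (s := (Ω : Set (Rn n)))
      (f := fun x => fderiv ℝ φ x v * ψ x)]
    · refine integral_congr_ae ?_
      filter_upwards [(memLp_gradient_test φ).coeFn_toLp] with x hx
      rw [← g1, ← hx]; rfl
    · intro x hx
      rw [image_eq_zero_of_notMem_tsupport fun h => hx (ψ.tsupport_subset h), mul_zero]
  have cd : ∀ χ : 𝓓(Ω, ℝ), Continuous fun x => fderiv ℝ χ x v := fun χ =>
    (χ.contDiff.continuous_fderiv (by simp)).clm_apply continuous_const
  rw [l1, l2]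
  refine integral_mul_fderiv_eq_neg_fderiv_mul_of_integrable ?_ ?_ ?_
    (fun x _ => differentiable_test φ x) (fun x _ => differentiable_test ψ x)
  · exact ((cd φ).mul ψ.continuous).integrable_of_hasCompactSupport
      (ψ.hasCompactSupport.mul_left)
  · exact (φ.continuous.mul (cd ψ)).integrable_of_hasCompactSupport
      (φ.hasCompactSupport.mul_right)
  · exact (φ.continuous.mul ψ.continuous).integrable_of_hasCompactSupport
      (φ.hasCompactSupport.mul_right)

end FreeBoundary

end

/-! This is the direct method. Below the fundamental tone, `‖∇u‖² - λ‖u‖²` dominates `c‖u‖²` in the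
`H¹` norm (`exists_coercive`). Since `-2∫fu` is linear and the measure term is nonnegative, the
energy is bounded below on `K(Ω)` and minimizing sequences are bounded, so a subsequence converges
weakly to some `v` (`exists_subseq_tendsto_inner`).

Coercivity also makes the quadratic part convex, hence weakly lower semicontinuous
(`quadratic_lower_bound`). This absorbs the term `-λ‖u‖²`, so strong `L²` convergence is never
needed. The only term that is not weakly well behaved is `∫ g² χ_{u>0}`. It is lower semicontinuous
under a.e. convergence, because `u_k(x) → v(x) > 0` forces `u_k(x) > 0` eventually
(`exists_tendsto_le_positivityEnergy`).

A.e. convergence of a subsequence, which also gives `v ≥ 0`, follows from an `L¹` form of Rellich's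
theorem (`tendsto_eLpNorm_fst_of_weak`). A test function differs in `L¹` from its averages over
balls of radius `r` by at most `r‖∇φ‖₁`, and at fixed `r` weak convergence makes these averages
converge. -/

namespace FreeBoundary

open Filter Topology

/-! ### Translation and averaging estimates in `L¹` -/

/-- `L¹` continuity of translations, quantified by the derivative. -/
theorem lintegral_enorm_translate_sub_le {n : ℕ} {φ : Rn n → ℝ} (hφ : ContDiff ℝ 1 φ) (h : Rn n) :
    ∫⁻ x, ‖φ (x + h) - φ x‖ₑ ≤ ‖h‖ₑ * ∫⁻ x, ‖fderiv ℝ φ x‖ₑ := by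
  have hc : Continuous (fderiv ℝ φ) := hφ.continuous_fderiv (by simp)
  have hpt : ∀ x, ‖φ (x + h) - φ x‖ₑ ≤
      ‖h‖ₑ * ∫⁻ t in Set.Ioc (0 : ℝ) 1, ‖fderiv ℝ φ (x + t • h)‖ₑ := fun x => by
    have hline : ∀ t : ℝ, HasDerivAt (fun t : ℝ => φ (x + t • h)) (fderiv ℝ φ (x + t • h) h) t := by
      intro t
      have h1 : HasDerivAt (fun t : ℝ => x + t • h) h t := by
        simpa using ((hasDerivAt_id t).smul_const h).const_add x
      exact ((hφ.differentiable (by simp) _).hasFDerivAt).comp_hasDerivAt t h1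
    have hci : Continuous fun t : ℝ => fderiv ℝ φ (x + t • h) h := by fun_prop
    have key := intervalIntegral.integral_eq_sub_of_hasDerivAt (a := 0) (b := 1)
      (fun t _ => hline t) (hci.intervalIntegrable _ _)
    simp only [one_smul, zero_smul, add_zero] at key
    rw [← key, intervalIntegral.integral_of_le zero_le_one,
      ← lintegral_const_mul _ (by fun_prop)]
    refine (enorm_integral_le_lintegral_enorm _).trans (lintegral_mono fun t => ?_)
    rw [mul_comm]
    exact (fderiv ℝ φ (x + t • h)).le_opENorm h
  refine (lintegral_mono hpt).trans ?_
  have hm : Measurable fun p : Rn n × ℝ => ‖fderiv ℝ φ (p.1 + p.2 • h)‖ₑ := by fun_prop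
  -- After Tonelli, translation invariance makes the integral over `x` independent of `t`.
  rw [lintegral_const_mul _ hm.lintegral_prod_right', lintegral_lintegral_swap hm.aemeasurable]
  gcongr
  simp_rw [lintegral_add_right_eq_self (fun x => ‖fderiv ℝ φ x‖ₑ)]
  simp

/-- A `C¹` function is controlled in `L¹` by its averages over balls of radius `r` and by its
derivative. -/
theorem lintegral_enorm_le_average_add {n : ℕ} {φ : Rn n → ℝ} (hφ : ContDiff ℝ 1 φ)
    (s : Set (Rn n)) {r : ℝ} (hr : 0 < r) :
    ∫⁻ x in s, ‖φ x‖ₑ ≤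
      (∫⁻ x in s, ‖⨍ y in Metric.ball 0 r, φ (x + y)‖ₑ) +
        ENNReal.ofReal r * ∫⁻ x, ‖fderiv ℝ φ x‖ₑ := by
  set B : Set (Rn n) := Metric.ball 0 r
  have hB0 : volume B ≠ 0 := (Metric.measure_ball_pos volume _ hr).ne'
  have hBt : volume B ≠ ⊤ := measure_ball_lt_top.ne
  have hc := hφ.continuous
  have hint : ∀ x, IntegrableOn (fun y => φ (x + y)) B := fun x =>
    ((show Continuous fun y => φ (x + y) by fun_prop).continuousOn.integrableOn_compact
      (isCompact_closedBall (0 : Rn n) r)).mono_set Metric.ball_subset_closedBall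
  have hpt : ∀ x, ‖φ x‖ₑ ≤ ‖⨍ y in B, φ (x + y)‖ₑ +
      (volume B)⁻¹ * ∫⁻ y in B, ‖φ (x + y) - φ x‖ₑ := fun x => by
    have h1 : φ x = (⨍ y in B, φ (x + y)) - ⨍ y in B, (φ (x + y) - φ x) := by
      rw [setAverage_eq, setAverage_eq, integral_sub (hint x) (integrableOn_const hBt), smul_sub]
      have : volume.real B ≠ 0 := (measureReal_ne_zero_iff hBt).2 hB0
      simp [this]
    calc ‖φ x‖ₑ = ‖(⨍ y in B, φ (x + y)) - ⨍ y in B, (φ (x + y) - φ x)‖ₑ := by rw [← h1]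
      _ ≤ ‖⨍ y in B, φ (x + y)‖ₑ + ‖⨍ y in B, (φ (x + y) - φ x)‖ₑ := enorm_sub_le
      _ ≤ _ := by
        gcongr
        rw [setAverage_eq, enorm_smul]
        gcongr
        · rw [Real.enorm_eq_ofReal (by positivity), measureReal_def, ENNReal.ofReal_inv_of_pos
            (ENNReal.toReal_pos hB0 hBt), ENNReal.ofReal_toReal hBt]
        · exact enorm_integral_le_lintegral_enorm _
  have hm : Measurable fun p : Rn n × Rn n => ‖φ (p.1 + p.2) - φ p.1‖ₑ := by fun_prop
  refine (lintegral_mono hpt).trans ?_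
  rw [lintegral_add_right _ (hm.lintegral_prod_right'.const_mul _)]
  gcongr
  rw [lintegral_const_mul _ hm.lintegral_prod_right']
  -- Enlarging `s` to the whole space makes the translation estimate applicable for each `y` in the
  -- ball, where `‖y‖ ≤ r`.
  refine (mul_le_mul_right (setLIntegral_le_lintegral _ _) _).trans ?_
  rw [lintegral_lintegral_swap hm.aemeasurable]
  calc (volume B)⁻¹ * ∫⁻ y in B, ∫⁻ x, ‖φ (x + y) - φ x‖ₑ
      ≤ (volume B)⁻¹ * ∫⁻ y in B, ENNReal.ofReal r * ∫⁻ x, ‖fderiv ℝ φ x‖ₑ := by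
        gcongr 1
        refine setLIntegral_mono' measurableSet_ball fun y hy => ?_
        refine (lintegral_enorm_translate_sub_le hφ y).trans ?_
        gcongr
        rw [← ofReal_norm]
        exact ENNReal.ofReal_le_ofReal (by simpa using (mem_ball_zero_iff.1 hy).le)
    _ = _ := by
        rw [setLIntegral_const, mul_comm, mul_assoc, ENNReal.mul_inv_cancel hB0 hBt, mul_one]

/-! ### Rellich compactness on `H¹₀(Ω)` -/

variable {n : ℕ} {Ω : TopologicalSpace.Opens (Rn n)}

theorem contDiff_one_test (φ : 𝓓(Ω, ℝ)) : ContDiff ℝ 1 (φ : Rn n → ℝ) :=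
  φ.contDiff.of_le (by simp)

theorem norm_fst_testGraph_le (φ : 𝓓(Ω, ℝ)) :
    eLpNorm φ 2 (volume.restrict (Ω : Set (Rn n))) ≤ ENNReal.ofReal ‖testGraph Ω φ‖ := by
  have h := WithLp.norm_fst_le _ (testGraph Ω φ)
  refine le_trans (le_of_eq ?_) (ENNReal.ofReal_le_ofReal h)
  change _ = ENNReal.ofReal ‖(memLp_test φ).toLp φ‖
  rw [Lp.norm_toLp, ENNReal.ofReal_toReal (memLp_test φ).2.ne]

theorem norm_snd_testGraph_le (φ : 𝓓(Ω, ℝ)) :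
    eLpNorm (∇ (φ : Rn n → ℝ)) 2 (volume.restrict (Ω : Set (Rn n))) ≤
      ENNReal.ofReal ‖testGraph Ω φ‖ := by
  have h := WithLp.norm_snd_le _ (testGraph Ω φ)
  refine le_trans (le_of_eq ?_) (ENNReal.ofReal_le_ofReal h)
  change _ = ENNReal.ofReal ‖(memLp_gradient_test φ).toLp (∇ φ)‖
  rw [Lp.norm_toLp, ENNReal.ofReal_toReal (memLp_gradient_test φ).2.ne]

theorem lintegral_enorm_le_eLpNorm_two {α F : Type*} [MeasurableSpace α] [NormedAddCommGroup F]
    {μ : Measure α} {u : α → F} (hu : AEStronglyMeasurable u μ) :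
    ∫⁻ x, ‖u x‖ₑ ∂μ ≤ eLpNorm u 2 μ * μ Set.univ ^ (1 / 2 : ℝ) := by
  have := eLpNorm_le_eLpNorm_mul_rpow_measure_univ (p := 1) (q := 2) (by norm_num) hu
  rw [eLpNorm_one_eq_lintegral_enorm] at this
  convert this using 3
  norm_num

theorem lintegral_enorm_fderiv_test (φ : 𝓓(Ω, ℝ)) :
    ∫⁻ x, ‖fderiv ℝ φ x‖ₑ = ∫⁻ x in (Ω : Set (Rn n)), ‖∇ (φ : Rn n → ℝ) x‖ₑ := by
  have h : ∀ x, ‖∇ (φ : Rn n → ℝ) x‖ₑ = ‖fderiv ℝ φ x‖ₑ := fun x => by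
    rw [gradient, LinearIsometryEquiv.enorm_map]
  simp_rw [h]
  refine (setLIntegral_eq_of_support_subset fun x hx => ?_).symm
  by_contra hxΩ
  apply hx
  have : fderiv ℝ φ x = 0 := image_eq_zero_of_notMem_tsupport
    fun h => hxΩ (φ.tsupport_subset (tsupport_fderiv_subset ℝ h))
  change ‖fderiv ℝ φ x‖ₑ = 0
  rw [← h, gradient, this, map_zero, enorm_zero]

/-- Writes the average as an `L²(Ω)` pairing with a fixed indicator, so that weak convergence
applies to it at each `x`. -/
theorem average_translate_test (φ : 𝓓(Ω, ℝ)) (x : Rn n) (r : ℝ) :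
    ⨍ y in Metric.ball 0 r, φ (x + y) = (volume.real (Metric.ball (0 : Rn n) r))⁻¹ *
      ∫ z in (Ω : Set (Rn n)), (Metric.ball x r).indicator 1 z * φ z := by
  rw [setAverage_eq, smul_eq_mul]
  congr 1
  rw [← integral_indicator measurableSet_ball, ← integral_indicator Ω.isOpen.measurableSet,
    ← integral_add_left_eq_self (Set.indicator (Ω : Set (Rn n)) _) x]
  refine integral_congr_ae (Eventually.of_forall fun y => ?_)
  beta_reduce
  by_cases hy : y ∈ Metric.ball 0 r
  · have hy' : x + y ∈ Metric.ball x r := by simpa using hy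
    by_cases hΩ : x + y ∈ (Ω : Set (Rn n))
    · rw [Set.indicator_of_mem hy, Set.indicator_of_mem hΩ, Set.indicator_of_mem hy',
        Pi.one_apply, one_mul]
    · rw [Set.indicator_of_mem hy, Set.indicator_of_notMem hΩ]
      exact image_eq_zero_of_notMem_tsupport fun h => hΩ (φ.tsupport_subset h)
  · have hy' : x + y ∉ Metric.ball x r := by simpa using hy
    by_cases hΩ : x + y ∈ (Ω : Set (Rn n))
    · rw [Set.indicator_of_notMem hy, Set.indicator_of_mem hΩ, Set.indicator_of_notMem hy',
        zero_mul]
    · rw [Set.indicator_of_notMem hy, Set.indicator_of_notMem hΩ]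

/-- Rellich's theorem for test functions: weak convergence in `H¹₀` forces convergence
in `L¹`. -/
theorem tendsto_lintegral_enorm_test (hb : Bornology.IsBounded (Ω : Set (Rn n)))
    {φ : ℕ → 𝓓(Ω, ℝ)} {M : ℝ} (hM : ∀ k, ‖testGraph Ω (φ k)‖ ≤ M)
    (hw : ∀ q : L2Pair Ω, Tendsto (fun k => inner ℝ q (testGraph Ω (φ k))) atTop (𝓝 0)) :
    Tendsto (fun k => ∫⁻ x in (Ω : Set (Rn n)), ‖φ k x‖ₑ) atTop (𝓝 0) := by
  have hfin : IsFiniteMeasure (volume.restrict (Ω : Set (Rn n))) :=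
    ⟨by simpa using hb.measure_lt_top⟩
  set μ := volume.restrict (Ω : Set (Rn n)) with hμ
  set C : ℝ≥0∞ := ENNReal.ofReal M * μ Set.univ ^ (1 / 2 : ℝ) with hC
  have hCt : C ≠ ⊤ := ENNReal.mul_ne_top ENNReal.ofReal_ne_top
    (ENNReal.rpow_ne_top_of_nonneg (by norm_num) (measure_ne_top _ _))
  have hL1 : ∀ k, ∫⁻ x, ‖φ k x‖ₑ ∂μ ≤ C := fun k =>
    (lintegral_enorm_le_eLpNorm_two (memLp_test (φ k)).1).trans <| by
      change _ ≤ ENNReal.ofReal M * _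
      gcongr
      exact (norm_fst_testGraph_le _).trans (ENNReal.ofReal_le_ofReal (hM k))
  have hD : ∀ k, ∫⁻ x, ‖fderiv ℝ (φ k) x‖ₑ ≤ C := fun k => by
    rw [lintegral_enorm_fderiv_test]
    refine (lintegral_enorm_le_eLpNorm_two (memLp_gradient_test (φ k)).1).trans ?_
    change _ ≤ ENNReal.ofReal M * _
    gcongr
    exact (norm_snd_testGraph_le _).trans (ENNReal.ofReal_le_ofReal (hM k))
  have hind : ∀ x r, MemLp ((Metric.ball x r).indicator (1 : Rn n → ℝ)) 2 μ := fun x r =>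
    memLp_indicator_const 2 measurableSet_ball 1 (Or.inr (measure_ne_top _ _))
  have havg : ∀ r : ℝ, 0 < r →
      Tendsto (fun k => ∫⁻ x, ‖⨍ y in Metric.ball 0 r, φ k (x + y)‖ₑ ∂μ) atTop (𝓝 0) := by
    intro r hr
    set c := (volume.real (Metric.ball (0 : Rn n) r))⁻¹
    have hlim : ∀ x, Tendsto (fun k => ‖⨍ y in Metric.ball 0 r, φ k (x + y)‖ₑ) atTop (𝓝 0) := by
      intro x
      have h1 := (hw (WithLp.toLp 2 ((hind x r).toLp _, 0))).const_mul c
      rw [mul_zero] at h1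
      have h2 := (continuous_enorm.tendsto (0 : ℝ)).comp h1
      rw [enorm_zero] at h2
      refine h2.congr fun k => ?_
      rw [average_translate_test, Function.comp_apply]
      congr 2
      rw [WithLp.prod_inner_apply]
      change inner ℝ ((hind x r).toLp _) ((memLp_test (φ k)).toLp _) + inner ℝ 0 _ = _
      rw [inner_zero_left, add_zero, L2.inner_def]
      refine integral_congr_ae ?_
      filter_upwards [(hind x r).coeFn_toLp, (memLp_test (φ k)).coeFn_toLp] with z h1 h2
      rw [h1, h2]
      simp [mul_comm]
    -- A bound uniform in `k` and `x` is an integrable majorant because `Ω` has finite measure.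
    have hbd : ∀ k x, ‖⨍ y in Metric.ball 0 r, φ k (x + y)‖ₑ ≤ ‖c‖ₑ * C := fun k x => by
      rw [average_translate_test, enorm_mul]
      gcongr
      refine (enorm_integral_le_lintegral_enorm _).trans (le_trans (lintegral_mono fun z => ?_)
        (hL1 k))
      by_cases hz : z ∈ Metric.ball x r <;> simp [hz]
    have h0 := tendsto_lintegral_of_dominated_convergence (μ := μ)
      (F := fun k x => ‖⨍ y in Metric.ball 0 r, φ k (x + y)‖ₑ) (f := fun _ => 0)
      (fun _ => ‖c‖ₑ * C) ?_ (fun k => Eventually.of_forall (hbd k)) ?_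
      (Eventually.of_forall hlim)
    · simpa using h0
    · intro k
      have hm : StronglyMeasurable fun p : Rn n × Rn n => φ k (p.1 + p.2) :=
        ((φ k).continuous.comp (by fun_prop)).stronglyMeasurable
      simp_rw [setAverage_eq]
      exact ((hm.integral_prod_right' (ν := volume.restrict (Metric.ball 0 r))).const_smul
        c).enorm
    · rw [lintegral_const]
      exact ENNReal.mul_ne_top (ENNReal.mul_ne_top enorm_ne_top hCt) (measure_ne_top _ _)
  rw [ENNReal.tendsto_nhds_zero]
  intro ε hε
  -- The radius is fixed first, using the bound `C` on the gradients that is uniform in `k`; only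
  -- then does `k` tend to infinity.
  obtain ⟨r, hr, hrε⟩ : ∃ r : ℝ, 0 < r ∧ ENNReal.ofReal r * C ≤ ε / 2 := by
    have h1 : Tendsto (fun r : ℝ => ENNReal.ofReal r * C) (𝓝[>] 0) (𝓝 0) := by
      have : Tendsto (fun r : ℝ => ENNReal.ofReal r * C) (𝓝 0) (𝓝 (ENNReal.ofReal 0 * C)) :=
        ENNReal.Tendsto.mul_const (ENNReal.continuous_ofReal.tendsto 0) (Or.inr hCt)
      simpa using this.mono_left nhdsWithin_le_nhds
    obtain ⟨r, h2, h3⟩ := ((ENNReal.tendsto_nhds_zero.1 h1 (ε / 2) (ENNReal.half_pos hε.ne')).and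
      self_mem_nhdsWithin).exists
    exact ⟨r, h3, h2⟩
  filter_upwards [ENNReal.tendsto_nhds_zero.1 (havg r hr) (ε / 2) (ENNReal.half_pos hε.ne')]
    with k hk
  calc ∫⁻ x, ‖φ k x‖ₑ ∂μ ≤ _ := lintegral_enorm_le_average_add (contDiff_one_test (φ k)) _ hr
    _ ≤ ε / 2 + ε / 2 := by
      gcongr
      refine le_trans ?_ hrε
      gcongr
      exact hD k
    _ = ε := ENNReal.add_halves ε

/-- **Rellich's theorem**: a bounded sequence of `H¹₀(Ω)` that converges weakly to `0` converges
to `0` in `L¹(Ω)`. -/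
theorem tendsto_eLpNorm_fst_of_weak (hb : Bornology.IsBounded (Ω : Set (Rn n)))
    {w : ℕ → L2Pair Ω} (hwH : ∀ k, w k ∈ H10 Ω) {M : ℝ} (hM : ∀ k, ‖w k‖ ≤ M)
    (hw : ∀ q : L2Pair Ω, Tendsto (fun k => inner ℝ q (w k)) atTop (𝓝 0)) :
    Tendsto (fun k => eLpNorm (w k).fst 1 (volume.restrict (Ω : Set (Rn n)))) atTop (𝓝 0) := by
  have hfin : IsFiniteMeasure (volume.restrict (Ω : Set (Rn n))) :=
    ⟨by simpa using hb.measure_lt_top⟩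
  set μ := volume.restrict (Ω : Set (Rn n)) with hμ
  have happ : ∀ k : ℕ, ∃ φ : 𝓓(Ω, ℝ), ‖w k - testGraph Ω φ‖ < 1 / (k + 1 : ℝ) := fun k => by
    obtain ⟨_, ⟨φ, rfl⟩, h⟩ := Metric.mem_closure_iff.1 (hwH k) (1 / (k + 1 : ℝ)) (by positivity)
    exact ⟨φ, by rwa [← dist_eq_norm]⟩
  choose φ hφ using happ
  have hdiff : Tendsto (fun k => w k - testGraph Ω (φ k)) atTop (𝓝 0) :=
    squeeze_zero_norm (fun k => (hφ k).le) tendsto_one_div_add_atTop_nhds_zero_nat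
  have hφM : ∀ k, ‖testGraph Ω (φ k)‖ ≤ M + 1 := fun k => by
    have h1 : (1 : ℝ) / (k + 1) ≤ 1 := by
      rw [div_le_one (by positivity)]
      linarith [(Nat.cast_nonneg k : (0 : ℝ) ≤ k)]
    have h2 := norm_sub_le (w k) (w k - testGraph Ω (φ k))
    rw [sub_sub_cancel] at h2
    linarith [hM k, hφ k]
  have hφw : ∀ q : L2Pair Ω,
      Tendsto (fun k => inner ℝ q (testGraph Ω (φ k))) atTop (𝓝 0) := fun q => by
    have h1 : Tendsto (fun k => inner ℝ q (w k - testGraph Ω (φ k))) atTop (𝓝 0) := by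
      simpa using (tendsto_const_nhds (x := q)).inner (𝕜 := ℝ) hdiff
    simpa [inner_sub_right] using (hw q).sub h1
  have hT := tendsto_lintegral_enorm_test hb hφM hφw
  have hfst : Tendsto (fun k => eLpNorm (w k - testGraph Ω (φ k)).fst 2 μ) atTop (𝓝 0) := by
    have h1 : Tendsto (fun k => (w k - testGraph Ω (φ k)).fst) atTop (𝓝 0) :=
      squeeze_zero_norm (fun k => (WithLp.norm_fst_le _ _).trans (hφ k).le)
        tendsto_one_div_add_atTop_nhds_zero_nat
    have h2 := h1.enorm
    simpa [Lp.enorm_def] using h2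
  have hfst1 : Tendsto (fun k => eLpNorm (w k - testGraph Ω (φ k)).fst 1 μ) atTop (𝓝 0) := by
    have h1 := ENNReal.Tendsto.mul_const (b := μ Set.univ ^ (1 / 2 : ℝ)) hfst
      (Or.inr (ENNReal.rpow_ne_top_of_nonneg (by norm_num) (measure_ne_top _ _)))
    rw [zero_mul] at h1
    refine tendsto_of_tendsto_of_tendsto_of_le_of_le tendsto_const_nhds h1 (fun _ => zero_le)
      fun k => ?_
    simp only [eLpNorm_one_eq_lintegral_enorm]
    exact lintegral_enorm_le_eLpNorm_two (Lp.aestronglyMeasurable _)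
  have hsum := hfst1.add hT
  rw [zero_add] at hsum
  refine tendsto_of_tendsto_of_tendsto_of_le_of_le tendsto_const_nhds hsum (fun _ => zero_le)
    fun k => ?_
  have hae : ⇑(w k).fst =ᵐ[μ] ⇑(w k - testGraph Ω (φ k)).fst + ⇑(φ k) := by
    have h1 : (w k).fst = (w k - testGraph Ω (φ k)).fst + (memLp_test (φ k)).toLp (φ k) := by
      change (w k).fst = (w k - testGraph Ω (φ k)).fst + (testGraph Ω (φ k)).fst
      rw [← WithLp.add_fst, sub_add_cancel]
    nth_rewrite 1 [h1]
    exact (Lp.coeFn_add _ _).trans (EventuallyEq.rfl.add (memLp_test (φ k)).coeFn_toLp)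
  simp only
  rw [eLpNorm_congr_ae hae]
  refine (eLpNorm_add_le (Lp.aestronglyMeasurable _) (memLp_test (φ k)).1 le_rfl).trans ?_
  rw [eLpNorm_one_eq_lintegral_enorm (f := ⇑(φ k))]

/-! ### Weak sequential compactness -/

/-- Bounded sequences in a separable Hilbert space have weakly convergent subsequences. -/
theorem exists_subseq_tendsto_inner {E : Type*} [NormedAddCommGroup E] [InnerProductSpace ℝ E]
    [CompleteSpace E] [TopologicalSpace.SeparableSpace E] {u : ℕ → E} {R : ℝ}
    (hu : ∀ k, ‖u k‖ ≤ R) :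
    ∃ v : E, ∃ ns : ℕ → ℕ, StrictMono ns ∧
      ∀ q, Tendsto (fun k => inner ℝ q (u (ns k))) atTop (𝓝 (inner ℝ q v)) := by
  have hmem : ∀ k, StrongDual.toWeakDual (InnerProductSpace.toDual ℝ E (u k)) ∈
      WeakDual.toStrongDual ⁻¹' Metric.closedBall (0 : StrongDual ℝ E) R := fun k => by
    change InnerProductSpace.toDual ℝ E (u k) ∈ Metric.closedBall (0 : StrongDual ℝ E) R
    rw [mem_closedBall_zero_iff, LinearIsometryEquiv.norm_map]
    exact hu k
  obtain ⟨a, -, ns, hns, ha⟩ := WeakDual.isSeqCompact_closedBall ℝ E 0 R hmem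
  refine ⟨(InnerProductSpace.toDual ℝ E).symm (WeakDual.toStrongDual a), ns, hns, fun q => ?_⟩
  have h := ((WeakDual.eval_continuous q).tendsto a).comp ha
  rw [real_inner_comm, InnerProductSpace.toDual_symm_apply]
  refine h.congr fun k => ?_
  rw [real_inner_comm]
  rfl

/-- Separability is what makes the Banach–Alaoglu theorem yield subsequences. -/
instance : TopologicalSpace.SeparableSpace (L2Pair Ω) := by
  have : Fact ((2 : ℝ≥0∞) ≠ ⊤) := ⟨by simp⟩
  have : SecondCountableTopology (Lp ℝ 2 (volume.restrict (Ω : Set (Rn n)))) :=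
    Lp.SecondCountableTopology
  have : SecondCountableTopology (Lp (Rn n) 2 (volume.restrict (Ω : Set (Rn n)))) :=
    Lp.SecondCountableTopology
  exact (WithLp.homeomorphProd 2 _ _).symm.surjective.denseRange.separableSpace
    (WithLp.homeomorphProd 2 _ _).symm.continuous

theorem norm_sq_eq_integral {α F : Type*} [MeasurableSpace α] {μ : Measure α}
    [NormedAddCommGroup F] [InnerProductSpace ℝ F] (u : Lp F 2 μ) :
    ‖u‖ ^ 2 = ∫ x, ‖u x‖ ^ 2 ∂μ := by
  rw [← real_inner_self_eq_norm_sq, L2.inner_def]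
  simp_rw [real_inner_self_eq_norm_sq]

/-! ### Coercivity and splitting of the energy -/

/-- The quadratic part of the energy is coercive on `H¹₀(Ω)` below the fundamental tone. -/
theorem exists_coercive {lam : ℝ} (hlam : (lam : EReal) < fundamentalTone Ω) :
    ∃ c : ℝ, 0 < c ∧ ∀ p ∈ H10 Ω, c * ‖p‖ ^ 2 ≤ ‖p.snd‖ ^ 2 - lam * ‖p.fst‖ ^ 2 := by
  obtain ⟨m, hm1, hm2⟩ := EReal.lt_iff_exists_real_btwn.1 hlam
  have hlm : lam < m := EReal.coe_lt_coe_iff.1 hm1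
  have hl : lam < max m 0 := lt_max_of_lt_left hlm
  have h0 : 0 ≤ max m 0 := le_max_right _ _
  -- Truncation at `0` makes `M + 1` positive and keeps `M‖φ‖² ≤ ‖∇φ‖²`. Then `(1 - c)‖∇φ‖² ≥ (1 -
  -- c)M‖φ‖²`, and this is at least `(λ + c)‖φ‖²` exactly when `c(M + 1) ≤ M - λ` (for `φ ≠ 0`),
  -- which dictates `c`.
  set M := max m 0 with hM
  set c := min 1 ((M - lam) / (M + 1)) with hc
  have hc0 : 0 < c := lt_min one_pos (div_pos (by linarith) (by linarith))
  have hc1 : c ≤ 1 := min_le_left _ _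
  have hc2 : c * (M + 1) ≤ M - lam := (le_div_iff₀ (by linarith)).1 (min_le_right _ _)
  refine ⟨c, hc0, fun p hp => ?_⟩
  have hcl : IsClosed {q : L2Pair Ω | c * ‖q‖ ^ 2 ≤ ‖q.snd‖ ^ 2 - lam * ‖q.fst‖ ^ 2} :=
    isClosed_le (by fun_prop) (by fun_prop)
  refine closure_minimal ?_ hcl hp
  rintro _ ⟨φ, rfl⟩
  have hA : ‖(testGraph Ω φ).snd‖ ^ 2 = ∫ x in (Ω : Set (Rn n)), ‖∇ (φ : Rn n → ℝ) x‖ ^ 2 := by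
    rw [norm_sq_eq_integral]
    refine integral_congr_ae ?_
    filter_upwards [(memLp_gradient_test φ).coeFn_toLp] with x hx
    rw [← hx]; rfl
  have hB : ‖(testGraph Ω φ).fst‖ ^ 2 = ∫ x in (Ω : Set (Rn n)), (φ x) ^ 2 := by
    rw [norm_sq_eq_integral]
    refine integral_congr_ae ?_
    filter_upwards [(memLp_test φ).coeFn_toLp] with x hx
    rw [← hx, Real.norm_eq_abs, sq_abs]; rfl
  have hAB : M * ‖(testGraph Ω φ).fst‖ ^ 2 ≤ ‖(testGraph Ω φ).snd‖ ^ 2 := by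
    rcases le_total m 0 with h | h
    · rw [hM, max_eq_right h, zero_mul]; positivity
    rw [hM, max_eq_left h]
    by_cases hφ : φ = 0
    · simp [hφ]
    have h1 : (m : EReal) < _ := hm2.trans_le (iInf_le _ ⟨φ, hφ⟩)
    rw [EReal.coe_lt_coe_iff, ← hA, ← hB] at h1
    -- If the denominator vanished, the quotient would be the default value `0` and say nothing, but
    -- the bound is then trivial.
    rcases (sq_nonneg ‖(testGraph Ω φ).fst‖).eq_or_lt with h2 | h2
    · rw [← h2, mul_zero]; positivity
    · exact ((lt_div_iff₀ h2).1 h1).le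
  rw [Set.mem_ofPred_eq, WithLp.prod_norm_sq_eq_of_L2]
  nlinarith [sq_nonneg ‖(testGraph Ω φ).fst‖, mul_le_mul_of_nonneg_left hAB (sub_nonneg.2 hc1),
    mul_le_mul_of_nonneg_right hc2 (sq_nonneg ‖(testGraph Ω φ).fst‖)]

/-- The measure term `∫_Ω g² χ_{u > 0} dx` of the energy. -/
noncomputable def positivityEnergy (Ω : TopologicalSpace.Opens (Rn n)) (g : Rn n → ℝ)
    (p : L2Pair Ω) : ℝ :=
  ∫ x in (Ω : Set (Rn n)), (g x) ^ 2 * Set.indicator {y | 0 < p.fst y} (fun _ => (1 : ℝ)) x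

theorem measurableSet_fst_pos (p : L2Pair Ω) : MeasurableSet {y | 0 < p.fst y} :=
  measurableSet_lt measurable_const (Lp.stronglyMeasurable p.fst).measurable

theorem positivityEnergy_nonneg (g : Rn n → ℝ) (p : L2Pair Ω) : 0 ≤ positivityEnergy Ω g p :=
  integral_nonneg fun _ => mul_nonneg (sq_nonneg _) (Set.indicator_nonneg (by simp) _)

/-- Separates the quadratic form and the continuous linear functional, both handled by Hilbert space
arguments, from the discontinuous measure term. -/
theorem energy_eq {f g : Rn n → ℝ}
    (hf : MemLp f 2 (volume.restrict (Ω : Set (Rn n))))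
    (hg : MemLp g 2 (volume.restrict (Ω : Set (Rn n)))) (lam : ℝ) (p : L2Pair Ω) :
    energy Ω f g lam p = ‖p.snd‖ ^ 2 - lam * ‖p.fst‖ ^ 2 - 2 * inner ℝ (hf.toLp f) p.fst +
      positivityEnergy Ω g p := by
  have hu := Lp.memLp p.fst
  have hG : Integrable (fun x => ‖p.snd x‖ ^ 2) (volume.restrict (Ω : Set (Rn n))) :=
    (Lp.memLp p.snd).integrable_norm_pow (by simp)
  have h2 := hu.integrable_sq.const_mul lam
  have h3 := (hf.integrable_mul hu).const_mul 2
  have h4 : Integrable (fun x => (g x) ^ 2 *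
      Set.indicator {y | 0 < p.fst y} (fun _ => (1 : ℝ)) x) (volume.restrict (Ω : Set (Rn n))) := by
    refine (hg.integrable_sq.indicator (measurableSet_fst_pos p)).congr
      (Eventually.of_forall fun x => ?_)
    by_cases hx : 0 < p.fst x <;> simp [Set.indicator, hx]
  have hi : inner ℝ (hf.toLp f) p.fst = ∫ x in (Ω : Set (Rn n)), f x * p.fst x := by
    rw [L2.inner_def]
    refine integral_congr_ae ?_
    filter_upwards [hf.coeFn_toLp] with x hx
    rw [hx]; simp [mul_comm]
  rw [norm_sq_eq_integral, norm_sq_eq_integral, hi, ← integral_const_mul, ← integral_const_mul,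
    positivityEnergy]
  simp only [Real.norm_eq_abs, sq_abs]
  have e1 := integral_sub hG h2
  have e2 := integral_sub (hG.sub h2) h3
  have e3 := integral_add ((hG.sub h2).sub h3) h4
  simp only [Pi.sub_apply, Pi.mul_apply] at e1 e2 e3
  rw [← e1, ← e2, ← e3]
  simp only [energy, energyDensity, mul_assoc]

/-! ### Weak limits and lower semicontinuity -/

/-- Elements of `H¹₀(Ω)` form a weakly sequentially closed set. -/
theorem mem_H10_of_weak {u : ℕ → L2Pair Ω} {v : L2Pair Ω} (hu : ∀ k, u k ∈ H10 Ω)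
    (hw : ∀ q, Tendsto (fun k => inner ℝ q (u k)) atTop (𝓝 (inner ℝ q v))) : v ∈ H10 Ω := by
  have hcl : (H10 Ω).topologicalClosure = H10 Ω :=
    (Submodule.isClosed_topologicalClosure _).submodule_topologicalClosure_eq
  -- A closed subspace is its double orthogonal complement, and orthogonality to a fixed `q`
  -- survives weak limits.
  rw [← hcl, ← Submodule.orthogonal_orthogonal_eq_closure]
  intro q hq
  refine tendsto_nhds_unique (hw q) ?_
  simp_rw [fun k => Submodule.inner_left_of_mem_orthogonal (hu k) hq]
  exact tendsto_const_nhds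

/-- Expansion of the coercive quadratic form around the weak limit. -/
theorem quadratic_lower_bound {lam c : ℝ} (hc : 0 < c)
    (hco : ∀ p ∈ H10 Ω, c * ‖p‖ ^ 2 ≤ ‖p.snd‖ ^ 2 - lam * ‖p.fst‖ ^ 2) {u v : L2Pair Ω}
    (hu : u ∈ H10 Ω) (hv : v ∈ H10 Ω) :
    ‖v.snd‖ ^ 2 - lam * ‖v.fst‖ ^ 2 +
        2 * inner ℝ (WithLp.toLp 2 (-(lam • v.fst), v.snd) : L2Pair Ω) (u - v) ≤
      ‖u.snd‖ ^ 2 - lam * ‖u.fst‖ ^ 2 := by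
  -- With `Q` the quadratic form and `B` its polarization, `Q(u) = Q(v) + 2B(v, u - v) + Q(u - v)`,
  -- and coercivity makes the last term nonnegative.
  have h := hco (u - v) (Submodule.sub_mem _ hu hv)
  have h0 : 0 ≤ c * ‖u - v‖ ^ 2 := by positivity
  rw [WithLp.prod_inner_apply]
  change _ + 2 * (inner ℝ (-(lam • v.fst)) (u - v).fst + inner ℝ v.snd (u - v).snd) ≤ _
  rw [WithLp.sub_fst, WithLp.sub_snd] at h ⊢
  rw [inner_neg_left, inner_smul_left, inner_sub_right, inner_sub_right,
    real_inner_self_eq_norm_sq, real_inner_self_eq_norm_sq]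
  rw [norm_sub_sq_real u.fst, norm_sub_sq_real u.snd] at h
  rw [real_inner_comm u.fst v.fst, real_inner_comm u.snd v.snd, conj_trivial]
  linarith

/-- A weakly convergent sequence in `K(Ω)` has its limit in `K(Ω)` and a subsequence converging
almost everywhere. -/
theorem exists_subseq_ae_of_weak (hb : Bornology.IsBounded (Ω : Set (Rn n)))
    {u : ℕ → L2Pair Ω} {v : L2Pair Ω} (hu : ∀ k, u k ∈ constraintSet Ω) {R : ℝ}
    (hR : ∀ k, ‖u k‖ ≤ R)
    (hw : ∀ q, Tendsto (fun k => inner ℝ q (u k)) atTop (𝓝 (inner ℝ q v))) :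
    v ∈ constraintSet Ω ∧ ∃ ns : ℕ → ℕ, StrictMono ns ∧
      ∀ᵐ x ∂(volume.restrict (Ω : Set (Rn n))),
        Tendsto (fun k => (u (ns k)).fst x) atTop (𝓝 (v.fst x)) := by
  have hv : v ∈ H10 Ω := mem_H10_of_weak (fun k => (hu k).1) hw
  have hL1 := tendsto_eLpNorm_fst_of_weak hb (w := fun k => u k - v)
    (fun k => Submodule.sub_mem _ (hu k).1 hv) (M := R + ‖v‖)
    (fun k => (norm_sub_le _ _).trans (by gcongr; exact hR k)) fun q => by
      simpa [inner_sub_right] using (hw q).sub_const (inner ℝ q v)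
  have hmeas : TendstoInMeasure (volume.restrict (Ω : Set (Rn n))) (fun k => ⇑(u k).fst) atTop
      ⇑v.fst := by
    refine tendstoInMeasure_of_tendsto_eLpNorm one_ne_zero
      (fun k => Lp.aestronglyMeasurable _) (Lp.aestronglyMeasurable _) (hL1.congr fun k => ?_)
    refine eLpNorm_congr_ae ?_
    rw [WithLp.sub_fst]
    exact Lp.coeFn_sub _ _
  obtain ⟨ns, hns, hae⟩ := hmeas.exists_seq_tendsto_ae
  refine ⟨⟨hv, ?_⟩, ns, hns, hae⟩
  filter_upwards [hae, ae_all_iff.2 fun k => (hu k).2] with x hx h0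
  exact ge_of_tendsto' hx fun k => h0 (ns k)

/-- Lower semicontinuity of the measure term under almost everywhere convergence: it dominates a
sequence that converges to its value at the limit. -/
theorem exists_tendsto_le_positivityEnergy {g : Rn n → ℝ}
    (hg : MemLp g 2 (volume.restrict (Ω : Set (Rn n)))) {u : ℕ → L2Pair Ω} {v : L2Pair Ω}
    (hae : ∀ᵐ x ∂(volume.restrict (Ω : Set (Rn n))),
      Tendsto (fun k => (u k).fst x) atTop (𝓝 (v.fst x))) :
    ∃ b : ℕ → ℝ, (∀ k, b k ≤ positivityEnergy Ω g (u k)) ∧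
      Tendsto b atTop (𝓝 (positivityEnergy Ω g v)) := by
  have hmeas : ∀ s : Set (Rn n), MeasurableSet s → AEStronglyMeasurable
      (fun x => (g x) ^ 2 * s.indicator (fun _ => (1 : ℝ)) x)
      (volume.restrict (Ω : Set (Rn n))) := fun s hs =>
    hg.integrable_sq.1.mul (measurable_const.indicator hs).aestronglyMeasurable
  have hind : ∀ (s : Set (Rn n)) x, 0 ≤ s.indicator (fun _ => (1 : ℝ)) x ∧
      s.indicator (fun _ => (1 : ℝ)) x ≤ 1 := fun s x =>
    ⟨Set.indicator_nonneg (by simp) _, Set.indicator_le_self' (f := fun _ => (1 : ℝ)) (by simp) x⟩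
  have hbd : ∀ (s : Set (Rn n)) x,
      ‖(g x) ^ 2 * s.indicator (fun _ => (1 : ℝ)) x‖ ≤ (g x) ^ 2 := fun s x => by
    rw [Real.norm_of_nonneg (mul_nonneg (sq_nonneg _) (hind s x).1)]
    exact mul_le_of_le_one_right (sq_nonneg _) (hind s x).2
  have hint : ∀ s : Set (Rn n), MeasurableSet s → Integrable
      (fun x => (g x) ^ 2 * s.indicator (fun _ => (1 : ℝ)) x)
      (volume.restrict (Ω : Set (Rn n))) := fun s hs =>
    hg.integrable_sq.mono' (hmeas s hs) (Eventually.of_forall (hbd s))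
  have hms := fun k => (measurableSet_fst_pos (u k)).inter (measurableSet_fst_pos v)
  -- Intersecting with `{v > 0}` discards the points where `v ≤ 0`, on which the indicators of `{u_k
  -- > 0}` need not converge.
  refine ⟨fun k => ∫ x in (Ω : Set (Rn n)), (g x) ^ 2 *
    ({y | 0 < (u k).fst y} ∩ {y | 0 < v.fst y}).indicator (fun _ => (1 : ℝ)) x, fun k => ?_, ?_⟩
  · refine integral_mono (hint _ (hms k)) (hint _ (measurableSet_fst_pos _)) fun x => ?_
    refine mul_le_mul_of_nonneg_left ?_ (sq_nonneg _)
    exact Set.indicator_le_indicator_of_subset Set.inter_subset_left (fun _ => zero_le_one) x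
  · refine tendsto_integral_of_dominated_convergence (fun x => (g x) ^ 2)
      (fun k => hmeas _ (hms k)) hg.integrable_sq
      (fun k => Eventually.of_forall (hbd _)) ?_
    filter_upwards [hae] with x hx
    by_cases hv : 0 < v.fst x
    · refine tendsto_const_nhds.congr' ?_
      filter_upwards [hx.eventually_const_lt hv] with k hk
      simp [Set.indicator, hv, hk]
    · simp [Set.indicator, hv]

theorem zero_mem_constraintSet : (0 : L2Pair Ω) ∈ constraintSet Ω := by
  refine ⟨Submodule.zero_mem _, ?_⟩
  filter_upwards [Lp.coeFn_zero ℝ 2 (volume.restrict (Ω : Set (Rn n)))] with x hx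
  exact (show (0 : Lp ℝ 2 (volume.restrict (Ω : Set (Rn n)))) x = 0 from hx).ge

end FreeBoundary

/-! ### The direct method -/

theorem proposition3 {n : ℕ} (hn : 2 ≤ n) (Ω : TopologicalSpace.Opens (FreeBoundary.Rn n))
    (hΩ_bdd : Bornology.IsBounded (Ω : Set (FreeBoundary.Rn n)))
    (hΩ_lip : FreeBoundary.HasLipschitzBoundary (Ω : Set (FreeBoundary.Rn n)))
    (f g : FreeBoundary.Rn n → ℝ) (hf : MemLp f ∞ volume) (hg : MemLp g ∞ volume)
    (hg_nonneg : ∀ᵐ x ∂(volume : Measure (FreeBoundary.Rn n)), 0 ≤ g x)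
    (lam : ℝ) (hlam : (lam : EReal) < FreeBoundary.fundamentalTone Ω) :
    ∃ u ∈ FreeBoundary.constraintSet Ω, ∀ v ∈ FreeBoundary.constraintSet Ω,
      FreeBoundary.energy Ω f g lam u ≤ FreeBoundary.energy Ω f g lam v := by
  open FreeBoundary Filter Topology in
  have hfin : IsFiniteMeasure (volume.restrict (Ω : Set (Rn n))) :=
    ⟨by simpa using hΩ_bdd.measure_lt_top⟩
  have hf2 : MemLp f 2 (volume.restrict (Ω : Set (Rn n))) :=
    (hf.restrict _).mono_exponent le_top
  have hg2 : MemLp g 2 (volume.restrict (Ω : Set (Rn n))) :=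
    (hg.restrict _).mono_exponent le_top
  set E : L2Pair Ω → ℝ := energy Ω f g lam with hE
  have hEeq : ∀ p, E p = _ := energy_eq hf2 hg2 lam
  obtain ⟨c, hc, hco⟩ := exists_coercive hlam
  set F := hf2.toLp f
  have hlow : ∀ p ∈ constraintSet Ω, c * ‖p‖ ^ 2 - 2 * (‖F‖ * ‖p‖) ≤ E p := fun p hp => by
    rw [hEeq]
    have h1 := hco p hp.1
    have h2 : inner ℝ F p.fst ≤ ‖F‖ * ‖p‖ :=
      (real_inner_le_norm _ _).trans (by gcongr; exact WithLp.norm_fst_le _ _)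
    linarith [positivityEnergy_nonneg (Ω := Ω) g p]
  have hbdd : BddBelow (E '' constraintSet Ω) := by
    -- The minimum of `c t² - 2‖F‖t`, found by completing the square.
    refine ⟨-(‖F‖ ^ 2 / c), ?_⟩
    rintro _ ⟨p, hp, rfl⟩
    refine le_trans ?_ (hlow p hp)
    have h : 0 ≤ (c * ‖p‖ - ‖F‖) ^ 2 / c := by positivity
    have h' : (c * ‖p‖ - ‖F‖) ^ 2 / c = c * ‖p‖ ^ 2 - 2 * (‖F‖ * ‖p‖) + ‖F‖ ^ 2 / c := by
      field_simp
      ring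
    linarith
  obtain ⟨e, he_anti, he_lim, he_mem⟩ :=
    exists_seq_tendsto_sInf (Set.Nonempty.image E ⟨0, zero_mem_constraintSet⟩) hbdd
  choose u huK hue using he_mem
  -- Beyond this radius `c‖u k‖ - 2‖F‖ > 1 + |e 0|`; the final `+ 1` gives `‖u k‖ ≥ 1`, so the
  -- energy would exceed `|e 0|`.
  have hR : ∀ k, ‖u k‖ ≤ (2 * ‖F‖ + 1 + |e 0|) / c + 1 := fun k => by
    have h1 := hlow _ (huK k)
    rw [hue] at h1
    have h2 : e k ≤ |e 0| := (he_anti k.zero_le).trans (le_abs_self _)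
    by_contra! hlt
    have h3 : 0 ≤ (2 * ‖F‖ + 1 + |e 0|) / c := by positivity
    have h4 : 1 ≤ ‖u k‖ := by linarith
    have h5 : 2 * ‖F‖ + 1 + |e 0| < c * ‖u k‖ := by
      have : (2 * ‖F‖ + 1 + |e 0|) / c < ‖u k‖ := by linarith
      rwa [div_lt_iff₀' hc] at this
    nlinarith [abs_nonneg (e 0)]
  obtain ⟨v, ns, hns, hw⟩ := exists_subseq_tendsto_inner hR
  obtain ⟨hvK, ms, hms, hae⟩ :=
    exists_subseq_ae_of_weak hΩ_bdd (fun k => huK (ns k)) (fun k => hR (ns k)) hw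
  obtain ⟨b, hb, hblim⟩ := exists_tendsto_le_positivityEnergy hg2 hae
  have hw' : ∀ q, Tendsto (fun k => inner ℝ q (u (ns (ms k)))) atTop (𝓝 (inner ℝ q v)) :=
    fun q => (hw q).comp hms.tendsto_atTop
  set q₁ : L2Pair Ω := WithLp.toLp 2 (-(lam • v.fst), v.snd)
  set q₂ : L2Pair Ω := WithLp.toLp 2 (F, 0)
  have hq₂ : ∀ p : L2Pair Ω, inner ℝ q₂ p = inner ℝ F p.fst := fun p => by
    rw [WithLp.prod_inner_apply]
    change inner ℝ F p.fst + inner ℝ 0 p.snd = _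
    rw [inner_zero_left, add_zero]
  -- These are lower bounds for the energies of the subsequence: the quadratic part is replaced by
  -- its tangent at `v`, the measure term by `b k`.
  have hlim : Tendsto (fun k => ‖v.snd‖ ^ 2 - lam * ‖v.fst‖ ^ 2 +
      2 * inner ℝ q₁ (u (ns (ms k)) - v) - 2 * inner ℝ q₂ (u (ns (ms k))) + b k) atTop
      (𝓝 (E v)) := by
    have h1 : Tendsto (fun k => inner ℝ q₁ (u (ns (ms k)) - v)) atTop (𝓝 0) := by
      simpa [inner_sub_right] using (hw' q₁).sub_const (inner ℝ q₁ v)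
    have h2 := (((h1.const_mul 2).const_add (‖v.snd‖ ^ 2 - lam * ‖v.fst‖ ^ 2)).sub
      ((hw' q₂).const_mul 2)).add hblim
    rwa [mul_zero, add_zero, hq₂ v, ← hEeq v] at h2
  have hEv : E v ≤ sInf (E '' constraintSet Ω) := by
    refine le_of_tendsto_of_tendsto' hlim
      (he_lim.comp (hns.tendsto_atTop.comp hms.tendsto_atTop)) fun k => ?_
    simp only [Function.comp_apply]
    rw [← hue, hEeq, hq₂]
    have := quadratic_lower_bound hc hco (huK (ns (ms k))).1 hvK.1
    linarith [hb k]
  exact ⟨v, hvK, fun p hp => hEv.trans (csInf_le hbdd ⟨p, hp, rfl⟩)⟩
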